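/- **Conventions.** For $n\ge 0$ and $w\in S_n$ let $\ell(w)$ be the length (number of inversions) of $w$, and write $s_k$ for the transposition of $k$ and $k+1$. Put $p=\ell(w)$. Let $R(w)$ be the set of reduced words of $w$, i.e. sequences $a=(a_1,\dots,a_p)$ in $\{1,\dots,n-1\}$ with $w=s_{a_1}\cdots s_{a_p}$ (permutations are composed as functions), and let $K(a)$ be the set of $a$-compatible sequences, i.e. sequences of positive integers $i_1\le\cdots\le i_p$ with $i_j\le a_j$ for all $j$ and $i_j<i_{j+1}$ whenever $a_j<a_{j+1}$. The Schubert polynomial of $w$ is $$\mathfrak S_w=\sum_{a\in R(w)}\ \sum_{(i_1,\dots,i_p)\in K(a)}x_{i_1}\cdots x_{i_p}\in\mathbb Z[x_1,x_2,\dots].$$ Let $1\times w\in S_{n+1}$ be the permutation with one-line notation $1\,(w(1)+1)\cdots(w(n)+1)$. Let $e_i^k=\sum_{1\le r_1<\cdots<r_i\le k}x_{r_1}\cdots x_{r_i}$ (so $e_0^k=1$). Call a sequence $I=(i_1,i_2,\dots)$ of nonnegative integers with finitely many nonzero entries *admissible* if $i_k\le k$ for all $k\ge1$; the corresponding standard elementary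 monomial is $e_I=e_{i_1}^1e_{i_2}^2e_{i_3}^3\cdots$. If $I$ is admissible, so is $0I=(0,i_1,i_2,\dots)$. **Proposition.** Let $n\ge0$ and $w\in S_n$. Then $\mathfrak S_w$ and $\mathfrak S_{1\times w}$ have unique expansions $$\mathfrak S_w=\sum_I a^w_I\,e_I,\qquad \mathfrak S_{1\times w}=\sum_J b^{1\times w}_J\,e_J$$ as finite $\mathbb Z$-linear combinations of standard elementary monomials ($I$, $J$ admissible), and these expansions satisfy the weak stable property $$b^{1\times w}_{0I}=a^w_I\qquad\text{for every admissible } I.$$ -/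

import Mathlib

noncomputable section

namespace Schubert

open MvPolynomial

/-- The permutation `w × u ∈ S_{m+n}` with one-line notation
`w(1) ⋯ w(m) (u(1)+m) ⋯ (u(n)+m)`. -/
def cross {m n : ℕ} (w : Equiv.Perm (Fin m)) (u : Equiv.Perm (Fin n)) :
    Equiv.Perm (Fin (m + n)) :=
  finSumFinEquiv.permCongr (Equiv.sumCongr w u)

/-- The length `ℓ(w)`: the number of inversions of `w`. -/
def length {n : ℕ} (w : Equiv.Perm (Fin n)) : ℕ :=
  (Finset.univ.filter fun q : Fin n × Fin n => q.1 < q.2 ∧ w q.2 < w q.1).card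

/-- The adjacent transpositions of `S_n`. Letters are numbered from `0`: the letter `k` stands for
the transposition exchanging the `(k+1)`-st and the `(k+2)`-nd element of `{1, …, n}`. -/
def adjSwap {n : ℕ} (k : Fin (n - 1)) : Equiv.Perm (Fin n) :=
  Equiv.swap ⟨k, by omega⟩ ⟨k + 1, by omega⟩

/-- `a = (a_1, …, a_p)`, with `p = ℓ(w)`, is a reduced word of `w`: `w = s_{a_1} ⋯ s_{a_p}`
(permutations are composed as functions). -/
def IsReducedWord {n : ℕ} (w : Equiv.Perm (Fin n)) (a : Fin (length w) → Fin (n - 1)) : Prop :=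
  (List.ofFn fun j => adjSwap (a j)).prod = w

/-- `i = (i_1, …, i_p)` is `a`-compatible: it is weakly increasing, `i_j ≤ a_j` for all `j`, and
`i_j < i_{j+1}` whenever `a_j < a_{j+1}`. As `1 ≤ i_j ≤ a_j ≤ n - 1`, the entries of `i` range over
the same set as the letters (and are numbered from `0` as well). -/
def IsCompatible {p m : ℕ} (a i : Fin p → Fin m) : Prop :=
  Monotone i ∧ (∀ j, i j ≤ a j) ∧
    ∀ j k : Fin p, (j : ℕ) + 1 = k → a j < a k → i j < i k

open Classical in
/-- The Schubert polynomial of `w ∈ S_n`, as the sum of `x_{i_1} ⋯ x_{i_p}` over all reduced words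
`a` of `w` and all `a`-compatible sequences `i`. The ring is `ℤ[x_1, x_2, …]`, in which `X k` is the
variable `x_{k+1}`. -/
def schubertPoly {n : ℕ} (w : Equiv.Perm (Fin n)) : MvPolynomial ℕ ℤ :=
  ∑ a : Fin (length w) → Fin (n - 1) with IsReducedWord w a,
    ∑ i : Fin (length w) → Fin (n - 1) with IsCompatible a i,
      ∏ j, X (i j : ℕ)

/-- `e_i^k`, the elementary symmetric polynomial of degree `i` in `x_1, …, x_k`. -/
def elemSymm (i k : ℕ) : MvPolynomial ℕ ℤ :=
  rename (fun j : Fin k => (j : ℕ)) (esymm (Fin k) ℤ i)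

/-- The indices `I = (i_1, i_2, …)` of the standard elementary monomials: finitely supported
sequences of natural numbers with `i_k ≤ k` for all `k ≥ 1`. The entry `i_{k+1}` is `I.1 k`. -/
def Index : Type := {I : ℕ →₀ ℕ // ∀ k, I k ≤ k + 1}

/-- The standard elementary monomial `e_I = e_{i_1}^1 e_{i_2}^2 ⋯`; the factors with `i_k = 0` are
`e_0^k = 1`. -/
def elemMonomial (I : Index) : MvPolynomial ℕ ℤ :=
  I.1.prod fun k i => elemSymm i (k + 1)

/-- The index `0I = (0, i_1, i_2, …)`. -/
def zeroCons (I : Index) : Index :=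
  ⟨I.1.embDomain ⟨Nat.succ, Nat.succ_injective⟩, by
    rintro (_ | k)
    · rw [Finsupp.embDomain_of_notMem_range _ _ _ (by simp)]
      exact Nat.zero_le _
    · have h := Finsupp.embDomain_apply_self ⟨Nat.succ, Nat.succ_injective⟩ I.1 k
      simp only [Function.Embedding.coeFn_mk, Nat.succ_eq_add_one] at h
      rw [h]
      exact (I.2 k).trans (Nat.le_succ _)⟩

/-- The (finitely supported) integer coefficients `c` satisfy `f = ∑_I c_I e_I`. -/
def IsExpansion (f : MvPolynomial ℕ ℤ) (c : Index →₀ ℤ) : Prop :=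
  f = c.sum fun I z => z • elemMonomial I

end Schubert

end

noncomputable section

namespace Schubert

open MvPolynomial

/-! ### Elementary symmetric polynomials -/

/-! Set x_1 to 0 and shift the other variables down (`dropFirst`). This sends e_i^k to e_i^{k-1},
hence e_{0I} to e_I, and it kills every e_J with some j_k = k, that is, every J not of the form 0I.
It also sends the Schubert polynomial of 1 × w to that of w: the surviving compatible sequences
avoid 1, so their words avoid the letter 1 and are shifted words of w. Applied to the expansion of
the former, it gives an expansion of the latter with coefficients b_{0I}, and uniqueness finishes.

Existence and uniqueness say that the e_I form a ℤ-basis. They span because a product of two factors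
of the same level can be straightened into higher levels (`elemSymm_mul_elemSymm_mul_mem`). They are
independent because e_0^K, …, e_K^K are independent over polynomials symmetric in the first K + 1
variables (`eq_zero_of_sum_mul_elemSymm_eq_zero`). -/

theorem elemSymm_eq (i k : ℕ) :
    elemSymm i k = ∑ t ∈ (Finset.range k).powersetCard i, ∏ j ∈ t, X j := by
  have h : Finset.range k = (Finset.univ : Finset (Fin k)).map Fin.valEmbedding := by
    rw [Fin.map_valEmbedding_univ, Nat.Iio_eq_range]
  rw [h, Finset.powersetCard_map, Finset.sum_map]
  simp [elemSymm, esymm, map_sum, map_prod]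

theorem elemSymm_zero (k : ℕ) : elemSymm 0 k = 1 := by simp [elemSymm_eq]

theorem elemSymm_of_lt {i k : ℕ} (h : k < i) : elemSymm i k = 0 := by
  rw [elemSymm_eq, Finset.powersetCard_eq_empty.2 (by simpa using h), Finset.sum_empty]

theorem elemSymm_succ (i k : ℕ) :
    elemSymm (i + 1) (k + 1) = elemSymm (i + 1) k + X k * elemSymm i k := by
  simp only [elemSymm_eq]
  rw [Finset.range_add_one, Finset.powersetCard_succ_insert Finset.notMem_range_self,
    Finset.sum_union, Finset.sum_image, Finset.mul_sum]
  · congr 1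
    refine Finset.sum_congr rfl fun t ht => ?_
    rw [Finset.prod_insert]
    exact fun h => Finset.notMem_range_self ((Finset.mem_powersetCard.1 ht).1 h)
  · intro s hs t ht hst
    have hk : ∀ u ∈ (Finset.range k).powersetCard i, k ∉ u := fun u hu h =>
      Finset.notMem_range_self ((Finset.mem_powersetCard.1 hu).1 h)
    rw [← Finset.erase_insert (hk s hs), ← Finset.erase_insert (hk t ht)]
    exact congrArg (Finset.erase · k) hst
  · rw [Finset.disjoint_left]
    intro t ht ht'
    obtain ⟨u, -, rfl⟩ := Finset.mem_image.1 ht'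
    exact Finset.notMem_range_self ((Finset.mem_powersetCard.1 ht).1 (Finset.mem_insert_self k u))

theorem rename_elemSymm (σ : Equiv.Perm ℕ) (i : ℕ) {k : ℕ}
    (hσ : (Finset.range k).map σ.toEmbedding = Finset.range k) :
    rename σ (elemSymm i k) = elemSymm i k := by
  simp only [elemSymm_eq, map_sum, map_prod, rename_X]
  conv_rhs => rw [← hσ]
  rw [Finset.powersetCard_map, Finset.sum_map]
  simp

theorem map_swap_range {a b k : ℕ} (ha : a < k) (hb : b < k) :
    (Finset.range k).map (Equiv.swap a b).toEmbedding = Finset.range k := by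
  apply Finset.eq_of_subset_of_card_le
  · intro x hx
    obtain ⟨y, hy, rfl⟩ := Finset.mem_map.1 hx
    simp only [Equiv.coe_toEmbedding, Equiv.swap_apply_def, Finset.mem_range] at hy ⊢
    split_ifs <;> assumption
  · simp

theorem rename_swap_elemSymm (i : ℕ) {a b k : ℕ} (ha : a < k) (hb : b < k) :
    rename (Equiv.swap a b) (elemSymm i k) = elemSymm i k :=
  rename_elemSymm _ i (map_swap_range ha hb)

/-! ### Standard elementary monomials span -/

/-- Straightening: e_i^k (e_{j+1}^{k+1} - e_{j+1}^k) and e_j^k (e_{i+1}^{k+1} - e_{i+1}^k) both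
equal x e_i^k e_j^k, where x is the new variable. Modulo products with one factor at each of the
levels k and k + 1, this lowers i until e_0^k = 1. -/
theorem elemSymm_mul_elemSymm_mul_mem (S : Submodule ℤ (MvPolynomial ℕ ℤ)) (k : ℕ)
    (p : MvPolynomial ℕ ℤ) (h : ∀ a b, elemSymm a k * (elemSymm b (k + 1) * p) ∈ S) (i j : ℕ) :
    elemSymm i k * (elemSymm j k * p) ∈ S := by
  induction i generalizing j with
  | zero => simpa [elemSymm_zero] using h j 0
  | succ i ih =>
    have e : elemSymm (i + 1) k * (elemSymm j k * p) = elemSymm i k * (elemSymm (j + 1) k * p) -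
        elemSymm i k * (elemSymm (j + 1) (k + 1) * p) +
        elemSymm j k * (elemSymm (i + 1) (k + 1) * p) := by
      rw [elemSymm_succ, elemSymm_succ]; ring
    rw [e]
    exact S.add_mem (S.sub_mem (ih _) (h _ _)) (h _ _)

/-- The span of the products `e_{i_{k+1}}^{k+1} ⋯ e_{i_n}^n`. -/
def levelSpan (k n : ℕ) : Submodule ℤ (MvPolynomial ℕ ℤ) :=
  Submodule.span ℤ (Set.range fun I : ℕ → ℕ => ∏ l ∈ Finset.Ico k n, elemSymm (I l) (l + 1))

theorem elemSymm_mul_mem_levelSpan {k n : ℕ} (hk : k < n) (a : ℕ) {q : MvPolynomial ℕ ℤ}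
    (hq : q ∈ levelSpan (k + 1) n) : elemSymm a (k + 1) * q ∈ levelSpan k n := by
  induction hq using Submodule.span_induction with
  | mem x hx =>
    obtain ⟨I, rfl⟩ := hx
    refine Submodule.subset_span ⟨Function.update I k a, ?_⟩
    simp only [Finset.prod_eq_prod_Ico_succ_bot hk, Function.update_self]
    congr 1
    refine Finset.prod_congr rfl fun l hl => ?_
    rw [Function.update_of_ne]
    have := (Finset.mem_Ico.1 hl).1
    omega
  | zero => simp
  | add x y _ _ hx hy => rw [mul_add]; exact add_mem hx hy
  | smul z x _ hx => rw [mul_smul_comm]; exact Submodule.smul_mem _ _ hx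

/-- Each collision at the bottom level pushes one factor up a level; the last one lands just above
the top, so the range of levels grows by one. -/
theorem mul_mem_levelSpan_of_le {k n n' : ℕ} (hkn : k ≤ n) (j : ℕ)
    (hn : n + 1 = n') {q : MvPolynomial ℕ ℤ} (hq : q ∈ levelSpan k n) :
    elemSymm j (k + 1) * q ∈ levelSpan k n' := by
  subst hn
  induction hkn using Nat.decreasingInduction generalizing j q with
  | self =>
    have h1 : (1 : MvPolynomial ℕ ℤ) ∈ levelSpan (n + 1) (n + 1) :=
      Submodule.subset_span ⟨0, by simp⟩
    induction hq using Submodule.span_induction with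
    | mem x hx =>
      obtain ⟨I, rfl⟩ := hx
      simpa using elemSymm_mul_mem_levelSpan n.lt_succ_self j h1
    | zero => simp
    | add x y _ _ hx hy => rw [mul_add]; exact add_mem hx hy
    | smul z x _ hx => rw [mul_smul_comm]; exact Submodule.smul_mem _ _ hx
  | of_succ k hk ih =>
    induction hq using Submodule.span_induction with
    | mem x hx =>
      obtain ⟨I, rfl⟩ := hx
      simp only [Finset.prod_eq_prod_Ico_succ_bot hk]
      refine elemSymm_mul_elemSymm_mul_mem _ _ _ (fun a b => ?_) _ _
      exact elemSymm_mul_mem_levelSpan (by omega) a (ih b (Submodule.subset_span ⟨I, rfl⟩))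
    | zero => simp
    | add x y _ _ hx hy => rw [mul_add]; exact add_mem hx hy
    | smul z x _ hx => rw [mul_smul_comm]; exact Submodule.smul_mem _ _ hx

theorem elemSymm_mul_mem_levelSpan_of_le {m k n : ℕ} (hmk : m ≤ k) (hkn : k ≤ n) (j : ℕ)
    {q : MvPolynomial ℕ ℤ} (hq : q ∈ levelSpan m n) :
    elemSymm j (k + 1) * q ∈ levelSpan m (n + 1) := by
  induction hmk using Nat.decreasingInduction generalizing q with
  | self => exact mul_mem_levelSpan_of_le hkn j rfl hq
  | of_succ m hm ih =>
    induction hq using Submodule.span_induction with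
    | mem x hx =>
      obtain ⟨I, rfl⟩ := hx
      simp only [Finset.prod_eq_prod_Ico_succ_bot (show m < n by omega)]
      rw [mul_left_comm]
      exact elemSymm_mul_mem_levelSpan (by omega) _ (ih (Submodule.subset_span ⟨I, rfl⟩))
    | zero => simp
    | add x y _ _ hx hy => rw [mul_add]; exact add_mem hx hy
    | smul z x _ hx => rw [mul_smul_comm]; exact Submodule.smul_mem _ _ hx

theorem levelSpan_mono {k n n' : ℕ} (hkn : k ≤ n) (h : n ≤ n') :
    levelSpan k n ≤ levelSpan k n' := by
  induction h with
  | refl => exact le_rfl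
  | step h ih =>
    refine ih.trans fun q hq => ?_
    simpa [elemSymm_zero] using elemSymm_mul_mem_levelSpan_of_le le_rfl (hkn.trans h) 0 hq

theorem exists_mem_levelSpan (f : MvPolynomial ℕ ℤ) : ∃ n, f ∈ levelSpan 0 n := by
  have h1 : (1 : MvPolynomial ℕ ℤ) ∈ levelSpan 0 0 := Submodule.subset_span ⟨0, by simp⟩
  induction f using MvPolynomial.induction_on with
  | C z => exact ⟨0, by simpa [MvPolynomial.smul_eq_C_mul] using Submodule.smul_mem _ z h1⟩
  | add p q hp hq =>
    obtain ⟨m, hm⟩ := hp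
    obtain ⟨n, hn⟩ := hq
    exact ⟨max m n, add_mem (levelSpan_mono (Nat.zero_le _) (le_max_left _ _) hm)
      (levelSpan_mono (Nat.zero_le _) (le_max_right _ _) hn)⟩
  | mul_X p k hp =>
    obtain ⟨m, hm⟩ := hp
    have hm' := levelSpan_mono (Nat.zero_le _) (le_max_left m k) hm
    have h2 := elemSymm_mul_mem_levelSpan_of_le (Nat.zero_le k) (le_max_right m k) 1 hm'
    refine ⟨max m k + 1, ?_⟩
    have hX : elemSymm 1 (k + 1) = elemSymm 1 k + X k := by
      rw [elemSymm_succ, elemSymm_zero, mul_one]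
    -- The variable is e_1^{k+1} - e_1^k. For k = 0 the second term is zero and has no level of its
    -- own.
    cases k with
    | zero =>
      rw [hX, elemSymm_of_lt (by simp), zero_add] at h2
      rwa [mul_comm]
    | succ k =>
      have h3 := elemSymm_mul_mem_levelSpan_of_le (Nat.zero_le k)
        ((Nat.le_succ k).trans (le_max_right m (k + 1))) 1 hm'
      have := sub_mem h2 h3
      rwa [← sub_mul, hX, add_sub_cancel_left, mul_comm] at this

theorem elemMonomial_eq_prod (I : Index) {n : ℕ} (hn : ∀ l, n ≤ l → I.1 l = 0) :
    elemMonomial I = ∏ l ∈ Finset.range n, elemSymm (I.1 l) (l + 1) := by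
  refine Finsupp.prod_of_support_subset _ (fun l hl => ?_) _ fun _ _ => elemSymm_zero _
  by_contra h
  exact Finsupp.mem_support_iff.1 hl (hn l (by simpa using h))

theorem span_elemMonomial : Submodule.span ℤ (Set.range elemMonomial) = ⊤ := by
  refine eq_top_iff.2 fun f _ => ?_
  obtain ⟨n, hn⟩ := exists_mem_levelSpan f
  refine Submodule.span_le.2 ?_ hn
  rintro _ ⟨I, rfl⟩
  simp only [SetLike.mem_coe, Nat.Ico_zero_eq_range]
  -- Generators of `levelSpan` need not be admissible, but the inadmissible ones vanish.
  by_cases h : ∃ l ∈ Finset.range n, l + 1 < I l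
  · obtain ⟨l, hl, h⟩ := h
    rw [Finset.prod_eq_zero (f := fun l => elemSymm (I l) (l + 1)) hl (elemSymm_of_lt h)]
    exact zero_mem _
  · push Not at h
    let J : Index := ⟨Finsupp.onFinset (Finset.range n) (fun l => if l < n then I l else 0)
      (by simp +contextual), fun l => by
        by_cases hl : l < n
        · simpa [hl] using h l (by simpa using hl)
        · simp [hl]⟩
    refine Submodule.subset_span ⟨J, ?_⟩
    rw [elemMonomial_eq_prod J (n := n) fun l hl => by simp [J, hl.not_gt]]
    exact Finset.prod_congr rfl fun l hl => by simp [J, Finset.mem_range.1 hl]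

/-! ### Standard elementary monomials are linearly independent -/

/-- The polynomial in `T` whose value at `T = x_K` is `e_i^K`, written with coefficients that are
symmetric in `x_0, …, x_K`. -/
def elemSymmPoly (K : ℕ) : ℕ → Polynomial (MvPolynomial ℕ ℤ)
  | 0 => 1
  | i + 1 => Polynomial.C (elemSymm (i + 1) (K + 1)) - Polynomial.X * elemSymmPoly K i

theorem degree_elemSymmPoly (K i : ℕ) : (elemSymmPoly K i).degree = i := by
  induction i with
  | zero => simp [elemSymmPoly]
  | succ i ih =>
    have h : (Polynomial.X * elemSymmPoly K i).degree = ((i + 1 : ℕ) : WithBot ℕ) := by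
      rw [Polynomial.degree_mul, Polynomial.degree_X, ih, add_comm]; rfl
    rw [elemSymmPoly, Polynomial.degree_sub_eq_right_of_degree_lt, h]
    rw [h]
    exact Polynomial.degree_C_le.trans_lt (by exact_mod_cast i.succ_pos)

theorem eval_X_elemSymmPoly {K a : ℕ} (ha : a ≤ K) (i : ℕ) :
    (elemSymmPoly K i).eval (X a) = rename (Equiv.swap a K) (elemSymm i K) := by
  induction i with
  | zero => simp [elemSymmPoly, elemSymm_zero]
  | succ i ih =>
    have h := congrArg (rename (Equiv.swap a K)) (elemSymm_succ i K)
    rw [rename_swap_elemSymm _ (Nat.lt_succ_of_le ha) K.lt_succ_self, map_add, map_mul,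
      rename_X, Equiv.swap_apply_right] at h
    simp [elemSymmPoly, ih, h]

/-- Exchanging x_a with x_K fixes the coefficients, so the relation says that P vanishes at T = x_a.
Thus P has degree at most K and K + 1 distinct roots, so P = 0; its summands `elemSymmPoly K i` have
distinct degrees and are independent. -/
theorem eq_zero_of_sum_mul_elemSymm_eq_zero (K : ℕ) (f : ℕ → MvPolynomial ℕ ℤ)
    (hf : ∀ i, ∀ a ≤ K, rename (Equiv.swap a K) (f i) = f i)
    (h : ∑ i ∈ Finset.range (K + 1), f i * elemSymm i K = 0) :
    ∀ i ≤ K, f i = 0 := by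
  set P : Polynomial (MvPolynomial ℕ ℤ) := ∑ i ∈ Finset.range (K + 1), f i • elemSymmPoly K i
    with hP
  have hP0 : P = 0 := by
    refine Polynomial.eq_zero_of_natDegree_lt_card_of_eval_eq_zero P
      (f := fun a : Fin (K + 1) => (X (a : ℕ) : MvPolynomial ℕ ℤ)) ?_ ?_ ?_
    · exact (X_injective (R := ℤ) (σ := ℕ)).comp Fin.val_injective
    · intro a
      have ha : (a : ℕ) ≤ K := Nat.le_of_lt_succ a.2
      have h' := congrArg (rename (Equiv.swap (a : ℕ) K)) h
      simp only [map_sum, map_mul, map_zero] at h'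
      rw [hP, Polynomial.eval_finsetSum, ← h']
      exact Finset.sum_congr rfl fun i _ => by
        rw [Polynomial.eval_smul, eval_X_elemSymmPoly ha, hf i a ha, smul_eq_mul]
    · rw [Fintype.card_fin, Nat.lt_succ_iff, hP]
      refine Polynomial.natDegree_sum_le_of_forall_le _ _ fun i hi => ?_
      refine (Polynomial.natDegree_smul_le _ _).trans ?_
      rw [Polynomial.natDegree_eq_of_degree_eq_some (degree_elemSymmPoly K i)]
      exact Nat.le_of_lt_succ (Finset.mem_range.1 hi)
  let S : Polynomial.Sequence (MvPolynomial ℕ ℤ) := ⟨elemSymmPoly K, degree_elemSymmPoly K⟩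
  intro i hi
  exact linearIndependent_iff'.1 S.linearIndependent (Finset.range (K + 1)) f hP0 i
    (Finset.mem_range.2 (Nat.lt_succ_of_le hi))

theorem linearIndependent_elemMonomial : LinearIndependent ℤ elemMonomial := by
  classical
  rw [linearIndependent_iff']
  intro s c hs J hJ
  obtain ⟨n, hn⟩ : ∃ n, ∀ I ∈ s, ∀ l, n ≤ l → I.1 l = 0 := by
    refine ⟨(s.biUnion fun I => I.1.support).sup id + 1, fun I hI l hl => ?_⟩
    by_contra h
    have := Finset.le_sup (f := id)
      ((Finset.mem_biUnion (t := fun I : Index => I.1.support)).2 ⟨I, hI, Finsupp.mem_support_iff.2 h⟩)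
    simp only [id] at this
    omega
  -- Levels are peeled off from the bottom, keeping only the indices that agree with J so far. The
  -- remaining factors have level at least k + 2, so they are symmetric in the first k + 2
  -- variables, as the preceding lemma needs with K = k + 1.
  have key : ∀ k ≤ n, ∑ I ∈ s with ∀ l < k, I.1 l = J.1 l,
      c I • ∏ l ∈ Finset.Ico k n, elemSymm (I.1 l) (l + 1) = 0 := by
    intro k hk
    induction k with
    | zero =>
      rw [← hs]
      simp only [Nat.not_lt_zero, false_imp_iff, implies_true, Finset.filter_true,
        Nat.Ico_zero_eq_range]
      exact Finset.sum_congr rfl fun I hI => by rw [elemMonomial_eq_prod I (hn I hI)]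
    | succ k ih =>
      specialize ih (by omega)
      let f : ℕ → MvPolynomial ℕ ℤ := fun i =>
        ∑ I ∈ {I ∈ s | ∀ l < k, I.1 l = J.1 l} with I.1 k = i,
          c I • ∏ l ∈ Finset.Ico (k + 1) n, elemSymm (I.1 l) (l + 1)
      have hf : f (J.1 k) = 0 := by
        refine eq_zero_of_sum_mul_elemSymm_eq_zero (k + 1) f ?_ ?_ _ (J.2 k)
        · intro i a ha
          simp only [f, map_sum, map_zsmul, map_prod]
          refine Finset.sum_congr rfl fun I _ => ?_
          congr 1
          refine Finset.prod_congr rfl fun l hl => ?_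
          have := (Finset.mem_Ico.1 hl).1
          exact rename_swap_elemSymm _ (by omega) (by omega)
        · rw [← ih, ← Finset.sum_fiberwise_of_maps_to (t := Finset.range (k + 2))
            (g := fun I : Index => I.1 k)
            fun I _ => Finset.mem_range.2 (Nat.lt_succ_of_le (I.2 k))]
          refine Finset.sum_congr rfl fun i _ => ?_
          rw [Finset.sum_mul]
          refine Finset.sum_congr rfl fun I hI => ?_
          rw [Finset.prod_eq_prod_Ico_succ_bot (show k < n by omega), (Finset.mem_filter.1 hI).2,
            smul_mul_assoc, mul_comm]
      rw [← hf]
      simp only [f, Finset.filter_filter]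
      refine Finset.sum_congr (Finset.filter_congr fun I _ => ?_) fun _ _ => rfl
      exact Nat.forall_lt_succ_right
  have h := key n le_rfl
  have hJs : {I ∈ s | ∀ l < n, I.1 l = J.1 l} = {J} := by
    ext I
    simp only [Finset.mem_filter, Finset.mem_singleton]
    refine ⟨fun ⟨hI, hl⟩ => Subtype.ext (Finsupp.ext fun l => ?_), ?_⟩
    · rcases lt_or_ge l n with h | h
      · exact hl l h
      · rw [hn I hI l h, hn J hJ l h]
    · rintro rfl
      exact ⟨hJ, fun _ _ => rfl⟩
  simpa [hJs] using h

theorem existsUnique_isExpansion (f : MvPolynomial ℕ ℤ) :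
    ∃! c : Index →₀ ℤ, IsExpansion f c := by
  obtain ⟨c, hc⟩ := (Finsupp.mem_span_range_iff_exists_finsupp (R := ℤ) (v := elemMonomial)
    (x := f)).1 (span_elemMonomial ▸ Submodule.mem_top)
  refine ⟨c, hc.symm, fun d hd => linearIndependent_elemMonomial ?_⟩
  rw [Finsupp.linearCombination_apply, Finsupp.linearCombination_apply, hc]
  exact hd.symm

/-! ### Setting the first variable to zero -/

/-- The substitution `x_1 ↦ 0`, `x_{k+1} ↦ x_k`. -/
def dropFirst : MvPolynomial ℕ ℤ →ₐ[ℤ] MvPolynomial ℕ ℤ :=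
  aeval fun k => Nat.casesOn k 0 X

theorem dropFirst_X_zero : dropFirst (X 0) = 0 := by simp [dropFirst]

theorem dropFirst_X_succ (k : ℕ) : dropFirst (X (k + 1)) = X k := by simp [dropFirst]

theorem dropFirst_elemSymm (i k : ℕ) : dropFirst (elemSymm i (k + 1)) = elemSymm i k := by
  induction k generalizing i with
  | zero =>
    cases i with
    | zero => simp [elemSymm_zero]
    | succ i => simp [elemSymm_succ, elemSymm_of_lt, dropFirst_X_zero]
  | succ k ih =>
    cases i with
    | zero => simp [elemSymm_zero]
    | succ i => rw [elemSymm_succ, map_add, map_mul, ih, ih, dropFirst_X_succ, ← elemSymm_succ]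

theorem zeroCons_apply_zero (I : Index) : (zeroCons I).1 0 = 0 :=
  Finsupp.embDomain_of_notMem_range _ _ _ (by simp)

theorem zeroCons_apply_succ (I : Index) (k : ℕ) : (zeroCons I).1 (k + 1) = I.1 k :=
  Finsupp.embDomain_apply_self ⟨Nat.succ, Nat.succ_injective⟩ I.1 k

theorem zeroCons_injective : Function.Injective zeroCons := fun I J h =>
  Subtype.ext (Finsupp.ext fun k => by rw [← zeroCons_apply_succ, h, zeroCons_apply_succ])

theorem dropFirst_elemMonomial_zeroCons (I : Index) :
    dropFirst (elemMonomial (zeroCons I)) = elemMonomial I := by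
  have h : elemMonomial (zeroCons I) = I.1.prod fun k i => elemSymm i (k + 2) :=
    Finsupp.prod_embDomain
  rw [h, elemMonomial, Finsupp.prod, Finsupp.prod, map_prod]
  exact Finset.prod_congr rfl fun _ _ => dropFirst_elemSymm _ _

/-- An index outside the range has a maximal entry, and e_{k+1}^{k+1} maps to e_{k+1}^k = 0. -/
theorem dropFirst_elemMonomial_eq_zero {J : Index} (hJ : J ∉ Set.range zeroCons) :
    dropFirst (elemMonomial J) = 0 := by
  obtain ⟨k, hk⟩ : ∃ k, J.1 k = k + 1 := by
    by_contra! h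
    have hlt : ∀ k, J.1 k ≤ k := fun k => by have := J.2 k; have := h k; omega
    let I : Index := ⟨J.1.comapDomain Nat.succ Nat.succ_injective.injOn, fun k => hlt (k + 1)⟩
    refine hJ ⟨I, Subtype.ext (Finsupp.ext fun k => ?_)⟩
    cases k with
    | zero => rw [zeroCons_apply_zero]; exact (Nat.le_zero.1 (hlt 0)).symm
    | succ k => rw [zeroCons_apply_succ]; rfl
  rw [elemMonomial, Finsupp.prod, map_prod]
  refine Finset.prod_eq_zero (i := k) (by simp [hk]) ?_
  rw [dropFirst_elemSymm, hk, elemSymm_of_lt k.lt_succ_self]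

theorem IsExpansion.dropFirst {f : MvPolynomial ℕ ℤ} {b : Index →₀ ℤ} (h : IsExpansion f b) :
    IsExpansion (dropFirst f) (b.comapDomain zeroCons zeroCons_injective.injOn) := by
  classical
  rw [IsExpansion] at h ⊢
  rw [h, Finsupp.sum, Finsupp.sum, map_sum]
  symm
  refine Finset.sum_of_injOn zeroCons zeroCons_injective.injOn (fun I hI => ?_) ?_ ?_
  · simpa using hI
  · intro J hJ hJ'
    rw [map_zsmul, dropFirst_elemMonomial_eq_zero, smul_zero]
    rintro ⟨I, rfl⟩
    exact hJ' ⟨I, by simpa using hJ, rfl⟩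
  · intro I _
    rw [map_zsmul, dropFirst_elemMonomial_zeroCons, Finsupp.comapDomain_apply]

/-! ### Stability of Schubert polynomials -/

theorem cross_one_natAdd {n : ℕ} (w : Equiv.Perm (Fin n)) (k : Fin n) :
    cross (1 : Equiv.Perm (Fin 1)) w (Fin.natAdd 1 k) = Fin.natAdd 1 (w k) := by
  simp [cross, Equiv.permCongr_apply]

theorem cross_one_castAdd {n : ℕ} (w : Equiv.Perm (Fin n)) (k : Fin 1) :
    cross (1 : Equiv.Perm (Fin 1)) w (Fin.castAdd n k) = Fin.castAdd n k := by
  simp [cross, Equiv.permCongr_apply]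

theorem length_cross_one {n : ℕ} (w : Equiv.Perm (Fin n)) :
    length (cross (1 : Equiv.Perm (Fin 1)) w) = length w := by
  symm
  refine Finset.card_bij (fun q _ => (Fin.natAdd 1 q.1, Fin.natAdd 1 q.2)) ?_ ?_ ?_
  · intro q hq
    simpa [cross_one_natAdd] using hq
  · rintro ⟨a, b⟩ _ ⟨c, d⟩ _ h
    simpa using h
  · rintro ⟨a, b⟩ h
    simp only [Finset.mem_filter, Finset.mem_univ, true_and] at h
    induction a using Fin.addCases with
    | left a =>
      rw [cross_one_castAdd] at h
      exact absurd h.2 (by simp [Fin.lt_def])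
    | right a =>
      induction b using Fin.addCases with
      | left b => exact absurd h.1 (by simp [Fin.lt_def])
      | right b => exact ⟨(a, b), by simpa [cross_one_natAdd] using h, rfl⟩

theorem cross_one_injective {n : ℕ} :
    Function.Injective (cross (n := n) (1 : Equiv.Perm (Fin 1))) := fun w w' h =>
  Equiv.ext fun k => by
    have := congrArg (· (Fin.natAdd 1 k)) h
    simpa [cross_one_natAdd] using this

/-- The group homomorphism `w ↦ 1 × w`. -/
def crossOneHom (n : ℕ) : Equiv.Perm (Fin n) →* Equiv.Perm (Fin (1 + n)) where
  toFun := cross 1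
  map_one' := by
    ext k
    induction k using Fin.addCases <;> simp [cross_one_castAdd, cross_one_natAdd]
  map_mul' u v := by
    ext k
    induction k using Fin.addCases <;> simp [cross_one_castAdd, cross_one_natAdd]

/-- The letter of `S_{n+1}` following a given letter of `S_n`. -/
def succLetter {n : ℕ} (k : Fin (n - 1)) : Fin (1 + n - 1) := ⟨k + 1, by omega⟩

theorem succLetter_injective {n : ℕ} : Function.Injective (succLetter (n := n)) := fun j k h => by
  simpa [succLetter, Fin.ext_iff] using h

theorem succLetter_le_succLetter {n : ℕ} {j k : Fin (n - 1)} :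
    succLetter j ≤ succLetter k ↔ j ≤ k :=
  Nat.succ_le_succ_iff

theorem succLetter_lt_succLetter {n : ℕ} {j k : Fin (n - 1)} :
    succLetter j < succLetter k ↔ j < k :=
  Nat.succ_lt_succ_iff

theorem exists_succLetter_eq {n : ℕ} (k : Fin (1 + n - 1)) (hk : (k : ℕ) ≠ 0) :
    ∃ j : Fin (n - 1), succLetter j = k :=
  ⟨⟨k - 1, by omega⟩, Fin.ext (by simp only [succLetter]; omega)⟩

theorem exists_succLetter_comp_eq {n p : ℕ} (a : Fin p → Fin (1 + n - 1))
    (ha : ∀ j, (a j : ℕ) ≠ 0) : ∃ b : Fin p → Fin (n - 1), succLetter ∘ b = a := by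
  choose b hb using fun j => exists_succLetter_eq (a j) (ha j)
  exact ⟨b, funext hb⟩

theorem cross_one_adjSwap {n : ℕ} (k : Fin (n - 1)) :
    cross (1 : Equiv.Perm (Fin 1)) (adjSwap k) = adjSwap (succLetter k) := by
  ext j
  induction j using Fin.addCases with
  | left j =>
    rw [cross_one_castAdd, adjSwap, Equiv.swap_apply_of_ne_of_ne] <;>
      simp [Fin.ext_iff, succLetter]
  | right j =>
    rw [cross_one_natAdd, adjSwap, adjSwap, Equiv.swap_apply_def, Equiv.swap_apply_def]
    simp only [Fin.ext_iff, succLetter, Fin.val_natAdd]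
    split_ifs <;> simp <;> omega

theorem prod_adjSwap_succLetter_comp {n p : ℕ} (a : Fin p → Fin (n - 1)) :
    (List.ofFn fun j => adjSwap ((succLetter ∘ a) j)).prod =
      cross (1 : Equiv.Perm (Fin 1)) (List.ofFn fun j => adjSwap (a j)).prod := by
  have h := map_list_prod (crossOneHom n) (List.ofFn fun j => adjSwap (a j))
  rw [List.map_ofFn] at h
  refine Eq.trans ?_ h.symm
  congr 2
  exact funext fun j => (cross_one_adjSwap (a j)).symm

theorem isCompatible_succLetter_comp {n p : ℕ} (a i : Fin p → Fin (n - 1)) :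
    IsCompatible (succLetter ∘ a) (succLetter ∘ i) ↔ IsCompatible a i := by
  simp only [IsCompatible, Monotone, Function.comp_apply, succLetter_le_succLetter,
    succLetter_lt_succLetter]

/-- The word `a` of arbitrary length has product `w`. -/
def IsWord {n p : ℕ} (w : Equiv.Perm (Fin n)) (a : Fin p → Fin (n - 1)) : Prop :=
  (List.ofFn fun j => adjSwap (a j)).prod = w

theorem isWord_succLetter_comp {n p : ℕ} (w : Equiv.Perm (Fin n)) (a : Fin p → Fin (n - 1)) :
    IsWord (cross (1 : Equiv.Perm (Fin 1)) w) (succLetter ∘ a) ↔ IsWord w a := by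
  rw [IsWord, prod_adjSwap_succLetter_comp, cross_one_injective.eq_iff, IsWord]

open Classical in
/-- The sum of `x_{i_1} ⋯ x_{i_p}` over the words `a` of length `p` with product `w` and the
`a`-compatible sequences `i`. -/
def wordSum {n : ℕ} (p : ℕ) (w : Equiv.Perm (Fin n)) : MvPolynomial ℕ ℤ :=
  ∑ a : Fin p → Fin (n - 1) with IsWord w a,
    ∑ i : Fin p → Fin (n - 1) with IsCompatible a i, ∏ j, X (i j : ℕ)

/-- The summation types of `schubertPoly` depend on `length w`; making the number of letters a
parameter lets `length_cross_one` be rewritten. -/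
theorem schubertPoly_eq_wordSum {n : ℕ} (w : Equiv.Perm (Fin n)) :
    schubertPoly w = wordSum (length w) w := rfl

/-- A zero entry of i kills its term, and i ≤ a turns a zero letter into a zero entry. All that
survives is shifted by `succLetter`, which preserves compatibility. -/
theorem dropFirst_wordSum_cross_one {n : ℕ} (p : ℕ) (w : Equiv.Perm (Fin n)) :
    dropFirst (wordSum p (cross (1 : Equiv.Perm (Fin 1)) w)) = wordSum p w := by
  classical
  have hinj : Function.Injective fun a : Fin p → Fin (n - 1) => succLetter ∘ a :=
    succLetter_injective.comp_left
  have hvanish : ∀ (i : Fin p → Fin (1 + n - 1)) (j : Fin p), (i j : ℕ) = 0 →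
      ∏ j, dropFirst (X (i j : ℕ)) = 0 := fun i j h =>
    Finset.prod_eq_zero (Finset.mem_univ j) (by rw [h, dropFirst_X_zero])
  simp only [wordSum, map_sum, map_prod]
  symm
  refine Finset.sum_of_injOn (fun a => succLetter ∘ a) hinj.injOn ?_ ?_ ?_
  · intro a ha
    simpa [isWord_succLetter_comp] using ha
  · intro a ha ha'
    refine Finset.sum_eq_zero fun i hi => ?_
    by_contra h
    obtain ⟨b, rfl⟩ := exists_succLetter_comp_eq a fun j hj => by
      have hij : (i j : ℕ) ≤ a j := (Finset.mem_filter.1 hi).2.2.1 j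
      exact h (hvanish i j (by omega))
    exact ha' ⟨b, by simpa [isWord_succLetter_comp] using ha, rfl⟩
  · intro a _
    refine Finset.sum_of_injOn (fun i => succLetter ∘ i) hinj.injOn ?_ ?_ ?_
    · intro i hi
      simpa [isCompatible_succLetter_comp] using hi
    · intro i hi hi'
      by_contra h
      obtain ⟨b, rfl⟩ := exists_succLetter_comp_eq i fun j hj => h (hvanish i j hj)
      exact hi' ⟨b, by simpa [isCompatible_succLetter_comp] using hi, rfl⟩
    · intro i _
      exact Finset.prod_congr rfl fun j _ => (dropFirst_X_succ _).symm

theorem dropFirst_schubertPoly_cross_one {n : ℕ} (w : Equiv.Perm (Fin n)) :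
    dropFirst (schubertPoly (cross (1 : Equiv.Perm (Fin 1)) w)) = schubertPoly w := by
  rw [schubertPoly_eq_wordSum, schubertPoly_eq_wordSum, length_cross_one,
    dropFirst_wordSum_cross_one]

end Schubert

end

theorem mainTheorem7 (n : ℕ) (w : Equiv.Perm (Fin n)) :
    (∃! a : Schubert.Index →₀ ℤ, Schubert.IsExpansion (Schubert.schubertPoly w) a) ∧
    (∃! b : Schubert.Index →₀ ℤ, Schubert.IsExpansion
      (Schubert.schubertPoly (Schubert.cross (1 : Equiv.Perm (Fin 1)) w)) b) ∧
    ∀ a b : Schubert.Index →₀ ℤ,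
      Schubert.IsExpansion (Schubert.schubertPoly w) a →
      Schubert.IsExpansion
        (Schubert.schubertPoly (Schubert.cross (1 : Equiv.Perm (Fin 1)) w)) b →
      ∀ I : Schubert.Index, b (Schubert.zeroCons I) = a I := by
  refine ⟨Schubert.existsUnique_isExpansion _, Schubert.existsUnique_isExpansion _,
    fun a b ha hb I => ?_⟩
  have h := hb.dropFirst
  rw [Schubert.dropFirst_schubertPoly_cross_one] at h
  rw [(Schubert.existsUnique_isExpansion _).unique ha h, Finsupp.comapDomain_apply]
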